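/- Carathéodory's theorem (several variables). Let $n$ be a natural number, let $\Omega\subseteq\mathbb{C}^n$ be an open set and let $\mathcal F$ be a family of holomorphic functions $f:\Omega\to\mathbb{C}$. Let $s$ denote the chordal distance on $\mathbb{C}\cup\{\infty\}$, that is, for $z,w\in\mathbb{C}$, $$s(z,w)=\frac{|z-w|}{\sqrt{1+|z|^2}\,\sqrt{1+|w|^2}},\qquad s(z,\infty)=s(\infty,z)=\frac1{\sqrt{1+|z|^2}},\qquad s(\infty,\infty)=0.$$ Suppose that there is an $\varepsilon>0$ such that for each $f\in\mathcal F$ there exist distinct points $a_f,b_f\in\mathbb{C}$ with $f(z)\ne a_f$ and $f(z)\neq b_f$ for all $z\in\Omega$ and $$s(a_f,\infty)\,s(a_f,b_f)\,s(\infty,b_f)>\varepsilon .$$ Then $\mathcal F$ is normal on $\Omega$: every sequence in $\mathcal F$ has a subsequence which, on each connected component $U$ of $\Omega$, either converges uniformly on compact subsets of $U$ to a holomorphic function on $U$, or converges uniformly on compact subsets of $U$ to $\infty$. (In particular, if $\Omega$ is connected and non-empty, the subsequence converges uniformly on compact subsets of $\Omega$ either to a holomorphic function or to $\infty$.) -/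

import Mathlib

open Filter Topology

noncomputable section

/-- The chordal distance on the Riemann sphere `ℂ ∪ {∞}` (sphere of diameter `1`). -/
def chordalDist : OnePoint ℂ → OnePoint ℂ → ℝ
  | OnePoint.some z, OnePoint.some w => ‖z - w‖ / (√(1 + ‖z‖ ^ 2) * √(1 + ‖w‖ ^ 2))
  | OnePoint.some z, OnePoint.infty => 1 / √(1 + ‖z‖ ^ 2)
  | OnePoint.infty, OnePoint.some w => 1 / √(1 + ‖w‖ ^ 2)
  | OnePoint.infty, OnePoint.infty => 0

/-- The sequence `u` converges, uniformly on each compact subset of `U`, to a function that is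
holomorphic on `U`. -/
def ConvergesToHolomorphicOn {n : ℕ} (u : ℕ → EuclideanSpace ℂ (Fin n) → ℂ)
    (U : Set (EuclideanSpace ℂ (Fin n))) : Prop :=
  ∃ g : EuclideanSpace ℂ (Fin n) → ℂ, DifferentiableOn ℂ g U ∧
    ∀ K ⊆ U, IsCompact K → TendstoUniformlyOn u g atTop K

/-- The sequence `u` converges to `∞`, uniformly on each compact subset of `U`. -/
def ConvergesToInftyOn {n : ℕ} (u : ℕ → EuclideanSpace ℂ (Fin n) → ℂ)
    (U : Set (EuclideanSpace ℂ (Fin n))) : Prop :=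
  ∀ K ⊆ U, IsCompact K → ∀ M : ℝ, ∀ᶠ j in atTop, ∀ z ∈ K, M < ‖u j z‖

/-- Normality on an open set `Ω` of a family of holomorphic functions: every sequence in the family
has a subsequence that, on each connected component of `Ω`, converges uniformly on compact subsets
to a holomorphic function or converges uniformly on compact subsets to `∞`. If `Ω` is a domain, its
only component is `Ω` itself, and this is the usual definition. -/
def IsNormalFamilyOn {n : ℕ} (F : Set (EuclideanSpace ℂ (Fin n) → ℂ))
    (Ω : Set (EuclideanSpace ℂ (Fin n))) : Prop :=
  ∀ u : ℕ → EuclideanSpace ℂ (Fin n) → ℂ, (∀ j, u j ∈ F) →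
    ∃ φ : ℕ → ℕ, StrictMono φ ∧ ∀ p ∈ Ω,
      ConvergesToHolomorphicOn (fun j => u (φ j)) (connectedComponentIn Ω p) ∨
      ConvergesToInftyOn (fun j => u (φ j)) (connectedComponentIn Ω p)

end

/-! The chordal condition keeps all omitted pairs in a fixed disc and a fixed distance apart
(`norm_le_of_lt_chordalDist_mul`). Schottky's theorem then bounds every `f` in the family on a
half-ball in terms of a bound at the centre alone (`exists_schottky_bound`, reduced to one variable
along complex lines). Schottky itself comes from writing the normalised function as `cos (π cos (π
G))`: `G` misses a point of every disc of radius `3`, so Bloch's theorem bounds `G'`.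

Compactness of the sphere gives a subsequence converging in `ℂ ∪ {∞}` at each point of a countable
dense set. By Schottky, the behaviour at a nearby dense point spreads to a neighbourhood of any
point of `Ω`: the sequence is eventually uniformly bounded there, or tends uniformly to `∞`. Both
alternatives are open, so one holds throughout a component; in the bounded case Vitali's theorem
supplies the limit. -/

/-! ### Holomorphic logarithms and factorisation through the cosine. -/

section LogBranches

open Metric

/-- A nonvanishing holomorphic function on a disc has a holomorphic logarithm. -/
theorem Complex.exists_exp_eq_on_ball {f : ℂ → ℂ} {c : ℂ} {r : ℝ}
    (hf : DifferentiableOn ℂ f (ball c r)) (h0 : ∀ z ∈ ball c r, f z ≠ 0) :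
    ∃ L : ℂ → ℂ, DifferentiableOn ℂ L (ball c r) ∧ ∀ z ∈ ball c r, exp (L z) = f z := by
  rcases le_or_gt r 0 with hr | hr
  · refine ⟨f, hf, fun z hz => ?_⟩
    rw [ball_eq_empty.2 hr] at hz
    exact hz.elim
  have hc : c ∈ ball c r := mem_ball_self hr
  have hd : DifferentiableOn ℂ (fun z => deriv f z / f z) (ball c r) :=
    (hf.deriv isOpen_ball).div hf h0
  obtain ⟨L, hLc, hL⟩ := hd.isExactOn_ball.with_val_at c (log (f c))
  refine ⟨L, fun z hz => (hL z hz).differentiableAt.differentiableWithinAt, fun z hz => ?_⟩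
  have hder : ∀ w ∈ ball c r, HasDerivAt (fun z => f z * exp (-L z)) 0 w := by
    intro w hw
    have h1 := (hf.differentiableAt (isOpen_ball.mem_nhds hw)).hasDerivAt
    have h2 := h1.mul (hL w hw).neg.cexp
    refine h2.congr_deriv ?_
    have := h0 w hw
    field_simp
    ring
  have hconst := isOpen_ball.is_const_of_deriv_eq_zero (convex_ball c r).isPreconnected
    (fun w hw => (hder w hw).differentiableAt.differentiableWithinAt)
    (fun w hw => (hder w hw).deriv) hz hc
  simp only [hLc, exp_neg, exp_log (h0 c hc), mul_inv_cancel₀ (h0 c hc)] at hconst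
  have he := exp_ne_zero (L z)
  field_simp at hconst
  exact hconst.symm

/-- The modulus of `cos w` is at least `|sinh (Im w)|`, which dominates `|Im w|`. -/
theorem Complex.abs_im_le_norm_cos (w : ℂ) : |w.im| ≤ ‖cos w‖ := by
  have h1 : |Real.sinh w.im| ≤ ‖cos w‖ := by
    have h2 := abs_norm_sub_norm_le (exp (-w * I)) (-exp (w * I))
    rw [norm_neg, norm_exp, norm_exp, sub_neg_eq_add] at h2
    have h3 : cos w = (exp (-w * I) + exp (w * I)) / 2 := by rw [Complex.cos]; ring
    rw [h3, norm_div, Real.sinh_eq, abs_div]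
    simp only [neg_mul, neg_re, mul_re, I_re, mul_zero, I_im, mul_one, zero_sub, neg_neg] at h2
    simpa using div_le_div_of_nonneg_right h2 zero_le_two
  refine le_trans ?_ h1
  rw [Real.abs_sinh]
  exact Real.self_le_sinh_iff.2 (abs_nonneg _)

theorem Complex.norm_cos_le_exp_norm (w : ℂ) : ‖cos w‖ ≤ Real.exp ‖w‖ := by
  have h1 : ‖exp (w * I)‖ ≤ Real.exp ‖w‖ := by simpa using norm_exp_le_exp_norm (w * I)
  have h2 : ‖exp (-w * I)‖ ≤ Real.exp ‖w‖ := by simpa using norm_exp_le_exp_norm (-w * I)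
  rw [Complex.cos, norm_div, Complex.norm_ofNat, div_le_iff₀ zero_lt_two]
  linarith [norm_add_le (exp (w * I)) (exp (-w * I))]

/-- A holomorphic function on a disc that omits the values `1` and `-1` factors through
`w ↦ cos (π w)`, with control on the value at the centre. -/
theorem Complex.exists_cos_pi_mul_eq {f : ℂ → ℂ} {c : ℂ} {r : ℝ} (hr : 0 < r)
    (hf : DifferentiableOn ℂ f (ball c r)) (h1 : ∀ z ∈ ball c r, f z ≠ 1)
    (h2 : ∀ z ∈ ball c r, f z ≠ -1) :
    ∃ F : ℂ → ℂ, DifferentiableOn ℂ F (ball c r) ∧ (∀ z ∈ ball c r, cos (Real.pi * F z) = f z) ∧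
      ‖F c‖ ≤ 1 + ‖f c‖ := by
  have hc : c ∈ ball c r := mem_ball_self hr
  obtain ⟨K, hK, hKe⟩ := exists_exp_eq_on_ball (f := fun z => 1 - f z ^ 2)
    ((differentiableOn_const 1).sub (hf.pow 2)) (fun z hz h => by
      have h3 : (f z - 1) * (f z - -1) = 0 := by linear_combination -h
      rcases mul_eq_zero.1 h3 with h | h
      · exact h1 z hz (sub_eq_zero.1 h)
      · exact h2 z hz (sub_eq_zero.1 h))
  -- With `s` a square root of `1 - f²`, the functions `f ± i s` are mutually inverse, so `f + i s =
  -- exp L` and `f = cosh L`.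
  set s : ℂ → ℂ := fun z => exp (K z / 2) with hs
  have hs2 : ∀ z ∈ ball c r, s z ^ 2 = 1 - f z ^ 2 := fun z hz => by
    rw [← hKe z hz, hs, ← exp_nat_mul]; push_cast; ring_nf
  have hprod : ∀ z ∈ ball c r, (f z + I * s z) * (f z - I * s z) = 1 := fun z hz => by
    linear_combination (hs2 z hz) - s z ^ 2 * I_sq
  obtain ⟨L, hL, hLe⟩ := exists_exp_eq_on_ball (f := fun z => f z + I * s z)
    (hf.add ((differentiableOn_const I).mul (hK.div_const 2).cexp))
    (fun z hz h => by simpa [h] using hprod z hz)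
  have hpi : (Real.pi : ℂ) ≠ 0 := by exact_mod_cast Real.pi_ne_zero
  have hcos : ∀ z ∈ ball c r, cosh (L z) = f z := fun z hz => by
    have h3 : exp (-L z) = f z - I * s z := by
      rw [exp_neg, hLe z hz]
      exact inv_eq_of_mul_eq_one_right (hprod z hz)
    rw [Complex.cosh, hLe z hz, h3]; ring
  -- `cos (π ·)` has period `2`; the shift by `2k` brings the real part at the centre into `[-1,
  -- 1]`.
  set k : ℤ := round ((L c / (Real.pi * I)).re / 2) with hk
  have hval : ∀ z ∈ ball c r, cos (Real.pi * (L z / (Real.pi * I) - 2 * k)) = f z := fun z hz => by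
    have h3 : Real.pi * (L z / (Real.pi * I) - 2 * k) = -(L z * I) - k * (2 * Real.pi) := by
      have := I_ne_zero
      field_simp
      linear_combination L z * I_sq
    rw [h3, cos_sub_int_mul_two_pi, cos_neg, cos_mul_I, hcos z hz]
  refine ⟨fun z => L z / (Real.pi * I) - 2 * k, (hL.div_const _).sub_const _, hval, ?_⟩
  refine (norm_le_abs_re_add_abs_im _).trans (add_le_add ?_ ?_)
  · have h3 := abs_sub_round ((L c / (Real.pi * I)).re / 2)
    have h4 : (L c / (Real.pi * I) - 2 * k).re = 2 * ((L c / (Real.pi * I)).re / 2 - k) := by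
      rw [sub_re]; simp; ring
    rw [h4, abs_mul, abs_two]
    linarith
  · have h3 := abs_im_le_norm_cos (Real.pi * (L c / (Real.pi * I) - 2 * k))
    rw [hval c hc, im_ofReal_mul, abs_mul, abs_of_pos Real.pi_pos] at h3
    nlinarith [Real.pi_gt_three, abs_nonneg (L c / (Real.pi * I) - 2 * k).im]

/-- Every disc of radius `3` contains a point at which `cos (π w)` is an integer. -/
theorem Complex.exists_cos_pi_mul_eq_int (w : ℂ) :
    ∃ p : ℂ, ‖p - w‖ < 3 ∧ ∃ m : ℤ, cos (Real.pi * p) = m := by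
  wlog hw : 0 ≤ w.im generalizing w
  · obtain ⟨p, hp, m, hm⟩ := this (-w) (by simpa using (not_le.1 hw).le)
    refine ⟨-p, ?_, m, by rw [mul_neg, cos_neg, hm]⟩
    rwa [← norm_neg, neg_sub, sub_neg_eq_add, add_comm, ← sub_neg_eq_add]
  set t : ℝ := Real.pi * w.im with ht
  have ht0 : 0 ≤ t := mul_nonneg Real.pi_pos.le hw
  have hcosh2 : 2 ≤ Real.cosh 2 := by
    have h1 := Real.add_one_le_exp 2
    have h2 := Real.quadratic_le_exp_of_nonneg (zero_le_two (α := ℝ))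
    rw [Real.cosh_eq]
    linarith [Real.exp_pos (-2)]
  -- So `cosh` takes an integer value at some `t'` in `[t, t + 2]`. Over an integer real part,
  -- height `t' / π` gives `cos (π p) = ± cosh t'`.
  have hstep : Real.cosh t + 1 ≤ Real.cosh (t + 2) := by
    rw [Real.cosh_add]
    have h1 : 0 ≤ Real.sinh t * Real.sinh 2 :=
      mul_nonneg (Real.sinh_nonneg_iff.2 ht0) (Real.sinh_nonneg_iff.2 zero_le_two)
    nlinarith [Real.one_le_cosh t]
  obtain ⟨t', ⟨ht1, ht2⟩, ht3⟩ := intermediate_value_Icc (by linarith : t ≤ t + 2)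
    Real.continuous_cosh.continuousOn
    (show (⌈Real.cosh t⌉ : ℝ) ∈ Set.Icc (Real.cosh t) (Real.cosh (t + 2)) from
      ⟨Int.le_ceil _, (Int.ceil_lt_add_one _).le.trans hstep⟩)
  refine ⟨(round w.re : ℝ) + (t' / Real.pi : ℝ) * I, ?_, ?_⟩
  · refine (norm_le_abs_re_add_abs_im _).trans_lt ?_
    have h1 := abs_sub_round w.re
    have h2 : |t' / Real.pi - w.im| ≤ 1 := by
      have h3 : t' / Real.pi - w.im = (t' - t) / Real.pi := by
        have := Real.pi_ne_zero
        rw [ht]; field_simp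
      rw [h3, abs_of_nonneg (div_nonneg (by linarith) Real.pi_pos.le), div_le_one Real.pi_pos]
      linarith [Real.pi_gt_three]
    rw [abs_sub_comm] at h1
    simp only [sub_re, add_re, ofReal_re, mul_re, I_re, mul_zero, ofReal_im, I_im, mul_one,
      sub_self, add_zero, sub_im, add_im, mul_im, zero_add]
    linarith
  · have h1 : (Real.pi : ℂ) * ((round w.re : ℝ) + (t' / Real.pi : ℝ) * I)
        = (round w.re : ℤ) * Real.pi + (t' : ℝ) * I := by
      have : (Real.pi : ℂ) ≠ 0 := by exact_mod_cast Real.pi_ne_zero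
      push_cast
      field_simp
    rw [h1, cos_add_mul_I, sin_int_mul_pi, ← ofReal_cosh, ht3]
    have h2 : ∃ m : ℤ, cos ((round w.re : ℤ) * Real.pi) = m := by
      have h3 := Real.abs_cos_int_mul_pi (round w.re)
      have h4 : cos ((round w.re : ℤ) * Real.pi) = (Real.cos ((round w.re : ℤ) * Real.pi) : ℝ) := by
        push_cast; rfl
      rcases (abs_eq zero_le_one).1 h3 with h | h
      · exact ⟨1, by rw [h4, h]; simp⟩
      · exact ⟨-1, by rw [h4, h]; simp⟩
    obtain ⟨m, hm⟩ := h2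
    exact ⟨m * ⌈Real.cosh t⌉, by rw [hm]; push_cast; ring⟩

end LogBranches

/-! ### Theorems of Bloch and Schottky. -/

section Schottky

open Metric

/-- If the derivative of `f` at the centre of a disc is at least half its size anywhere in the disc,
the image of the disc contains a disc of comparable radius. -/
theorem Complex.ball_subset_image_of_norm_deriv_le {f : ℂ → ℂ} {p : ℂ} {t : ℝ} (ht : 0 < t)
    (hf : DifferentiableOn ℂ f (ball p t)) (hd : ∀ z ∈ ball p t, ‖deriv f z‖ ≤ 2 * ‖deriv f p‖) :
    ball (f p) (t * ‖deriv f p‖ / 24) ⊆ f '' ball p t := by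
  set D := ‖deriv f p‖ with hD
  rcases (norm_nonneg (deriv f p)).eq_or_lt with h0 | h0
  · rw [hD, ← h0]; simp
  have hp : p ∈ ball p t := mem_ball_self ht
  -- Schwarz lemma for `f' - f'(p)`, which is bounded by `3D`.
  have hlip : ∀ z ∈ ball p t, ‖deriv f z - deriv f p‖ ≤ 3 * D / t * ‖z - p‖ := by
    intro z hz
    have := dist_le_div_mul_dist_of_mapsTo_ball (hf.deriv isOpen_ball) (R₂ := 3 * D)
      (fun w hw => by
        rw [mem_closedBall, dist_eq_norm]
        linarith [norm_sub_le (deriv f w) (deriv f p), hd w hw]) hz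
    rwa [dist_eq_norm, dist_eq_norm] at this
  have hsub : closedBall p (t / 6) ⊆ ball p t := closedBall_subset_ball (by linarith)
  have hlow : ∀ z ∈ closedBall p (t / 6), D / 2 * ‖z - p‖ ≤ ‖f z - f p‖ := by
    intro z hz
    have h1 := (convex_closedBall p (t / 6)).norm_image_sub_le_of_norm_hasDerivWithin_le
      (f := fun w => f w - deriv f p * w) (f' := fun w => deriv f w - deriv f p) (C := D / 2)
      (fun w hw => by
        have h2 := (hf.differentiableAt (isOpen_ball.mem_nhds (hsub hw))).hasDerivAt
        have h3 := (h2.fun_sub ((hasDerivAt_id w).const_mul (deriv f p))).hasDerivWithinAt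
          (s := closedBall p (t / 6))
        rwa [mul_one] at h3)
      (fun w hw => by
        refine (hlip w (hsub hw)).trans ?_
        have h2 : ‖w - p‖ ≤ t / 6 := by rwa [← dist_eq_norm]
        calc 3 * D / t * ‖w - p‖ ≤ 3 * D / t * (t / 6) := by gcongr
          _ = D / 2 := by field_simp; ring)
      (mem_closedBall_self (by linarith)) hz
    have h3 : deriv f p * (z - p)
        = (f z - f p) - ((f z - deriv f p * z) - (f p - deriv f p * p)) := by ring
    have h4 := norm_sub_le (f z - f p) ((f z - deriv f p * z) - (f p - deriv f p * p))
    rw [← h3, norm_mul, ← hD] at h4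
    linarith
  -- Quantitative open mapping: the distance `t D / 12` on the sphere yields an image disc of half
  -- that radius.
  have himg := DiffContOnCl.ball_subset_image_closedBall (f := f) (z₀ := p) (r := t / 6)
    (ε := t * D / 12) (hf.mono (closure_ball_subset_closedBall.trans hsub)).diffContOnCl
    (by linarith)
    (fun z hz => by
      refine le_trans (le_of_eq ?_) (hlow z (sphere_subset_closedBall hz))
      rw [mem_sphere_iff_norm.1 hz]; ring)
    (by
      refine Eventually.frequently (f := 𝓝[≠] p) ?_ |>.filter_mono nhdsWithin_le_nhds
      filter_upwards [self_mem_nhdsWithin,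
        mem_nhdsWithin_of_mem_nhds (closedBall_mem_nhds p (by linarith : 0 < t / 6))] with z hz hz2
      have h1 : 0 < ‖z - p‖ := norm_sub_pos_iff.2 hz
      have h2 := hlow z hz2
      have h3 : 0 < ‖f z - f p‖ := lt_of_lt_of_le (by positivity) h2
      exact norm_sub_pos_iff.1 h3)
  refine (ball_subset_ball (le_of_eq ?_)).trans (himg.trans (Set.image_mono hsub))
  ring

/-- A form of **Bloch's theorem**: the image of a disc of radius `R` under `f` contains a disc of
radius `r ‖f'(c)‖ / 48` for each `r < R`. -/
theorem Complex.exists_ball_subset_image {f : ℂ → ℂ} {c : ℂ} {r R : ℝ} (hr : 0 < r) (hrR : r < R)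
    (hf : DifferentiableOn ℂ f (ball c R)) :
    ∃ w, ball w (r * ‖deriv f c‖ / 48) ⊆ f '' ball c R := by
  have hsub : closedBall c r ⊆ ball c R := closedBall_subset_ball hrR
  -- At a maximum of this weighted derivative, moving halfway to the boundary at most halves the
  -- weight, so `‖f'‖` at most doubles.
  obtain ⟨p, hp, hmax⟩ := (isCompact_closedBall c r).exists_isMaxOn
    (f := fun z => (r - dist z c) * ‖deriv f z‖) ⟨c, mem_closedBall_self hr.le⟩
    ((continuousOn_const.sub (continuous_id.dist continuous_const).continuousOn).mul
      ((hf.deriv isOpen_ball).continuousOn.mono hsub).norm)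
  have hc := hmax (mem_closedBall_self hr.le)
  simp only [Set.mem_ofPred_eq, dist_self, sub_zero] at hc
  rcases (mem_closedBall.1 hp).eq_or_lt with h | h
  · rw [h, sub_self, zero_mul] at hc
    refine ⟨0, ?_⟩
    rw [ball_eq_empty.2 (by linarith)]
    exact Set.empty_subset _
  set t := (r - dist p c) / 2 with ht
  have ht0 : 0 < t := by linarith
  have hpt : ∀ z ∈ ball p t, dist z c < r - t := fun z hz => by
    linarith [dist_triangle z p c, mem_ball.1 hz]
  have hptR : ball p t ⊆ ball c R := fun z hz => mem_ball.2 (by linarith [hpt z hz])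
  refine ⟨f p, (ball_subset_ball ?_).trans ((ball_subset_image_of_norm_deriv_le ht0
    (hf.mono hptR) (fun z hz => ?_)).trans (Set.image_mono hptR))⟩
  · have : r - dist p c = 2 * t := by rw [ht]; ring
    rw [this] at hc
    linarith
  · have h1 := hmax (mem_closedBall.2 (by linarith [hpt z hz] : dist z c ≤ r))
    simp only [Set.mem_ofPred_eq] at h1
    have h2 : t * ‖deriv f z‖ ≤ (r - dist z c) * ‖deriv f z‖ := by
      gcongr; linarith [hpt z hz]
    have h3 : r - dist p c = 2 * t := by rw [ht]; ring
    rw [h3] at h1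
    refine le_of_mul_le_mul_left ?_ ht0
    linarith

/-- **Schottky's theorem** on the unit disc, for the omitted values `1` and `-1`. -/
theorem Complex.norm_le_of_omits_one_neg_one {f : ℂ → ℂ} (hf : DifferentiableOn ℂ f (ball 0 1))
    (h1 : ∀ z ∈ ball (0 : ℂ) 1, f z ≠ 1) (h2 : ∀ z ∈ ball (0 : ℂ) 1, f z ≠ -1) {z : ℂ}
    (hz : ‖z‖ ≤ 1 / 2) :
    ‖f z‖ ≤ Real.exp (Real.pi * Real.exp (Real.pi * (‖f 0‖ + 290))) := by
  obtain ⟨F, hF, hFc, hF0⟩ := exists_cos_pi_mul_eq one_pos hf h1 h2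
  have hFint : ∀ z ∈ ball (0 : ℂ) 1, ∀ m : ℤ, F z ≠ m := by
    intro z hz m hm
    have h3 := hFc z hz
    have h4 : cos (Real.pi * m) = (Real.cos (m * Real.pi) : ℝ) := by
      push_cast; rw [mul_comm]
    rw [hm, h4] at h3
    rcases (abs_eq zero_le_one).1 (Real.abs_cos_int_mul_pi m) with h | h
    · exact h1 z hz (by rw [← h3, h]; simp)
    · exact h2 z hz (by rw [← h3, h]; simp)
  obtain ⟨G, hG, hGc, hG0⟩ := exists_cos_pi_mul_eq one_pos hF
    (fun z hz => by simpa using hFint z hz 1) (fun z hz => by simpa using hFint z hz (-1))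
  -- Beyond `576 = 3 · 48 · 4`, Bloch's disc would have radius above `3` and contain a point where
  -- `F = cos (π G)` is an integer.
  have hderiv : ∀ w ∈ closedBall (0 : ℂ) (1 / 2), ‖deriv G w‖ ≤ 576 := by
    intro w hw
    have hsub : ball w (1 / 2) ⊆ ball 0 1 := ball_subset_ball' (by
      linarith [mem_closedBall.1 hw])
    obtain ⟨q, hq⟩ := exists_ball_subset_image (r := 1 / 4) (by norm_num) (by norm_num)
      (hG.mono hsub)
    by_contra! hlt
    obtain ⟨p, hp, m, hm⟩ := exists_cos_pi_mul_eq_int q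
    obtain ⟨x, hx, rfl⟩ := hq (mem_ball_iff_norm.2 (hp.trans (by linarith)))
    exact hFint x (hsub hx) m (by rw [← hGc x (hsub hx), hm])
  have hzb : z ∈ closedBall (0 : ℂ) (1 / 2) := mem_closedBall_zero_iff.2 hz
  have hsub : closedBall (0 : ℂ) (1 / 2) ⊆ ball 0 1 := closedBall_subset_ball (by norm_num)
  have h5 := (convex_closedBall (0 : ℂ) (1 / 2)).norm_image_sub_le_of_norm_deriv_le
    (fun w hw => hG.differentiableAt (isOpen_ball.mem_nhds (hsub hw))) hderiv
    (mem_closedBall_self (by norm_num)) hzb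
  rw [sub_zero] at h5
  -- `290 = 2 + 576 / 2`: each cosine factorisation costs `1` at the centre.
  have hGz : ‖G z‖ ≤ ‖f 0‖ + 290 := by
    have := norm_sub_norm_le (G z) (G 0)
    linarith
  have hcos : ∀ (w : ℂ) (B : ℝ), ‖w‖ ≤ B →
      ‖cos (Real.pi * w)‖ ≤ Real.exp (Real.pi * B) := by
    intro w B hw
    refine (norm_cos_le_exp_norm _).trans (Real.exp_le_exp.2 ?_)
    rw [norm_mul, norm_real, Real.norm_of_nonneg Real.pi_pos.le]
    exact mul_le_mul_of_nonneg_left hw Real.pi_pos.le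
  rw [← hFc z (hsub hzb)]
  refine hcos _ _ ?_
  rw [← hGc z (hsub hzb)]
  exact hcos _ _ hGz

/-- **Schottky's theorem** on a ball of a complex normed space, for a pair of omitted values that
are bounded and bounded apart. -/
theorem exists_schottky_bound (E : Type*) [NormedAddCommGroup E] [NormedSpace ℂ E] {A δ : ℝ}
    (hδ : 0 < δ) (M : ℝ) :
    ∃ S : ℝ, ∀ (f : E → ℂ) (c : E) (r : ℝ) (a b : ℂ), DifferentiableOn ℂ f (ball c r) →
      ‖a‖ ≤ A → ‖b‖ ≤ A → δ ≤ ‖a - b‖ → (∀ z ∈ ball c r, f z ≠ a ∧ f z ≠ b) → ‖f c‖ ≤ M →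
      ∀ z ∈ ball c (r / 2), ‖f z‖ ≤ S := by
  set T := Real.exp (Real.pi * Real.exp (Real.pi * ((2 * M + 2 * A) / δ + 290))) with hT
  refine ⟨(2 * A * T + 2 * A) / 2, fun f c r a b hf ha hb hab hom hfc z hz => ?_⟩
  have hab0 : a - b ≠ 0 := norm_pos_iff.1 (hδ.trans_le hab)
  -- The complex line through `c` and `z`, with `z` at `t = 1/2`; `h` below moves the omitted values
  -- `a`, `b` to `1`, `-1`.
  set φ : ℂ → E := fun t => c + t • ((2 : ℂ) • (z - c)) with hφ
  have hmaps : ∀ t ∈ ball (0 : ℂ) 1, φ t ∈ ball c r := by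
    intro t ht
    rw [mem_ball_zero_iff] at ht
    have h1 : ‖z - c‖ < r / 2 := mem_ball_iff_norm.1 hz
    rw [mem_ball_iff_norm, hφ, add_sub_cancel_left, norm_smul, norm_smul, Complex.norm_ofNat]
    nlinarith [norm_nonneg t, norm_nonneg (z - c)]
  set h : ℂ → ℂ := fun t => (2 * f (φ t) - a - b) / (a - b) with hh
  have hdiff : DifferentiableOn ℂ h (ball 0 1) := by
    have h1 : DifferentiableOn ℂ (fun t => f (φ t)) (ball 0 1) :=
      hf.comp (by fun_prop) hmaps
    exact (((h1.const_mul 2).sub_const a).sub_const b).div_const _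
  have h1 : ∀ t ∈ ball (0 : ℂ) 1, h t ≠ 1 := fun t ht he => by
    rw [hh, div_eq_iff hab0] at he
    exact (hom _ (hmaps t ht)).1 (by linear_combination he / 2)
  have h2 : ∀ t ∈ ball (0 : ℂ) 1, h t ≠ -1 := fun t ht he => by
    rw [hh, div_eq_iff hab0] at he
    exact (hom _ (hmaps t ht)).2 (by linear_combination he / 2)
  have hbound := Complex.norm_le_of_omits_one_neg_one hdiff h1 h2 (z := 1 / 2) (by norm_num)
  have hh0 : ‖h 0‖ ≤ (2 * M + 2 * A) / δ := by
    have h3 : ‖2 * f c - a - b‖ ≤ 2 * M + 2 * A := by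
      have h4 := norm_sub_le (2 * f c - a) b
      have h5 := norm_sub_le (2 * f c) a
      rw [norm_mul, Complex.norm_ofNat] at h5
      linarith
    have h6 : h 0 = (2 * f c - a - b) / (a - b) := by simp [hh, hφ]
    rw [h6, norm_div]
    exact div_le_div₀ ((norm_nonneg _).trans h3) h3 hδ hab
  have hhT : ‖h (1 / 2)‖ ≤ T := by
    refine hbound.trans ?_
    rw [hT]
    have := Real.pi_pos
    gcongr
  have hfz : f z = ((a - b) * h (1 / 2) + a + b) / 2 := by
    have h3 : φ (1 / 2) = z := by simp [hφ, smul_smul]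
    rw [hh]
    simp only [h3]
    field_simp
    ring
  rw [hfz, norm_div, Complex.norm_ofNat]
  have h3 : ‖(a - b) * h (1 / 2)‖ ≤ 2 * A * T := by
    rw [norm_mul]
    exact mul_le_mul (by linarith [norm_sub_le a b]) hhT (norm_nonneg _)
      (by linarith [norm_nonneg a])
  gcongr
  linarith [norm_add_le ((a - b) * h (1 / 2) + a) b, norm_add_le ((a - b) * h (1 / 2)) a]

end Schottky

/-! ### Convergence of sequences of holomorphic functions on normed spaces. -/

section SeveralVariables

open Metric

/-- Makes countable powers of the sphere first countable, hence sequentially compact. -/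
theorem OnePoint.metrizableSpace_complex : TopologicalSpace.MetrizableSpace (OnePoint ℂ) :=
  (onePointEquivSphereOfFinrankEq (ι := Fin 3) (V := ℂ)
    (by simp [Complex.finrank_real_complex])).isEmbedding.metrizableSpace

/-- Countably many sequences of complex numbers have a common subsequence along which each of them
converges or tends to infinity. -/
theorem exists_subseq_tendsto_or_tendsto_norm_atTop {ι : Type*} [Countable ι] (x : ℕ → ι → ℂ) :
    ∃ φ : ℕ → ℕ, StrictMono φ ∧ ∀ i, (∃ l, Tendsto (fun j => x (φ j) i) atTop (𝓝 l)) ∨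
      Tendsto (fun j => ‖x (φ j) i‖) atTop atTop := by
  have := OnePoint.metrizableSpace_complex
  have : FirstCountableTopology (ι → OnePoint ℂ) := by
    let := TopologicalSpace.metrizableSpaceMetric (OnePoint ℂ)
    infer_instance
  obtain ⟨a, φ, hφ, ha⟩ := SeqCompactSpace.tendsto_subseq
    (fun j i => (x j i : OnePoint ℂ))
  refine ⟨φ, hφ, fun i => ?_⟩
  have hi := tendsto_pi_nhds.1 ha i
  rcases h : a i with _ | l
  · right
    rw [h] at hi
    rw [tendsto_norm_atTop_iff_cobounded, cobounded_eq_cocompact, ← coclosedCompact_eq_cocompact,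
      ← OnePoint.comap_coe_nhds_infty, tendsto_comap_iff]
    exact hi
  · left
    rw [h] at hi
    exact ⟨l, OnePoint.isOpenEmbedding_coe.tendsto_nhds_iff.2 hi⟩

variable {E : Type*} [NormedAddCommGroup E] [NormedSpace ℂ E]

/-- The **Weierstrass convergence theorem** on a locally compact complex normed space. -/
theorem TendstoLocallyUniformlyOn.differentiableOn_complex [LocallyCompactSpace E] {F : ℕ → E → ℂ}
    {g : E → ℂ} {U : Set E} (hU : IsOpen U) (hF : ∀ j, DifferentiableOn ℂ (F j) U)
    (h : TendstoLocallyUniformlyOn F g atTop U) : DifferentiableOn ℂ g U := by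
  have : ProperSpace E := ProperSpace.of_locallyCompactSpace ℂ
  intro x hx
  obtain ⟨r, hr, hrU⟩ := nhds_basis_closedBall.mem_iff.1 (hU.mem_nhds hx)
  have hcau := ((tendstoLocallyUniformlyOn_iff_forall_isCompact hU).1 h _ hrU
    (isCompact_closedBall x r)).uniformCauchySeqOn
  have hsub : ∀ y ∈ ball x (r / 2), ball y (r / 2) ⊆ closedBall x r := fun y hy =>
    (ball_subset_ball' (by linarith [mem_ball.1 hy])).trans ball_subset_closedBall
  have hdF : ∀ j, ∀ y ∈ ball x (r / 2), DifferentiableAt ℂ (F j) y := fun j y hy =>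
    (hF j).differentiableAt
      (mem_of_superset (ball_mem_nhds y (half_pos hr)) ((hsub y hy).trans hrU))
  -- Cauchy estimates on balls of radius `r / 2` transfer the uniform Cauchy property to the
  -- derivatives.
  have hdc : UniformCauchySeqOn (fun j => fderiv ℂ (F j)) atTop (ball x (r / 2)) := by
    rw [Metric.uniformCauchySeqOn_iff] at hcau ⊢
    intro ε hε
    obtain ⟨N, hN⟩ := hcau (ε * r / 8) (by positivity)
    refine ⟨N, fun m hm k hk y hy => ?_⟩
    have h1 : ‖fderiv ℂ (F m - F k) y‖ ≤ (ε * r / 4) / (r / 2) := by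
      refine Complex.norm_fderiv_le_div_of_mapsTo_ball
        (((hF m).sub (hF k)).mono ((hsub y hy).trans hrU)) (fun w hw => ?_) (half_pos hr)
      have h2 := hN m hm k hk w (hsub y hy hw)
      have h3 := hN m hm k hk y (hsub y hy (mem_ball_self (half_pos hr)))
      rw [dist_eq_norm] at h2 h3
      rw [mem_closedBall, dist_eq_norm]
      refine (norm_sub_le _ _).trans ?_
      simp only [Pi.sub_apply]
      linarith
    rw [fderiv_sub (hdF m y hy) (hdF k y hy)] at h1
    rw [dist_eq_norm]
    refine h1.trans_lt ?_
    have : ε * r / 4 / (r / 2) = ε / 2 := by field_simp; norm_num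
    linarith
  have hlim : ∀ y ∈ ball x (r / 2), ∃ l, Tendsto (fun j => fderiv ℂ (F j) y) atTop (𝓝 l) :=
    fun y hy => cauchy_map_iff_exists_tendsto.1 (hdc.cauchy_map hy)
  choose! g' hg' using hlim
  exact (hasFDerivAt_of_tendstoUniformlyOn isOpen_ball (hdc.tendstoUniformlyOn_of_tendsto hg')
    (fun j y hy => (hdF j y hy).hasFDerivAt)
    (fun y hy => h.tendsto_at (hrU (hsub y hy (mem_ball_self (half_pos hr)))))
    (mem_ball_self (half_pos hr))).differentiableAt.differentiableWithinAt

/-- A locally bounded sequence of holomorphic functions that converges on a dense set converges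
locally uniformly to a holomorphic function (**Vitali**). -/
theorem exists_tendstoLocallyUniformlyOn_of_tendsto_dense [LocallyCompactSpace E] {v : ℕ → E → ℂ}
    {W D : Set E} (hW : IsOpen W) (hv : ∀ j, DifferentiableOn ℂ (v j) W) (hD : Dense D)
    (hbd : ∀ p ∈ W, ∃ r > 0, ∃ S : ℝ, ball p r ⊆ W ∧ ∀ᶠ j in atTop, ∀ z ∈ ball p r, ‖v j z‖ ≤ S)
    (hlim : ∀ d ∈ D, d ∈ W → ∃ l, Tendsto (fun j => v j d) atTop (𝓝 l)) :
    ∃ g : E → ℂ, DifferentiableOn ℂ g W ∧ TendstoLocallyUniformlyOn v g atTop W := by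
  -- Equicontinuity, by the Schwarz lemma and local boundedness.
  have hosc : ∀ p ∈ W, ∀ ε > 0, ∃ r > 0, ball p r ⊆ W ∧
      ∀ᶠ j in atTop, ∀ z ∈ ball p r, dist (v j z) (v j p) < ε := by
    intro p hp ε hε
    obtain ⟨r, hr, S, hrW, hS⟩ := hbd p hp
    have hT : 0 < |S| + 1 := by positivity
    refine ⟨min r (ε * r / (2 * (|S| + 1))), lt_min hr (by positivity),
      (ball_subset_ball (min_le_left _ _)).trans hrW, ?_⟩
    filter_upwards [hS] with j hj z hz
    have h1 := Complex.dist_le_div_mul_dist_of_mapsTo_ball ((hv j).mono hrW)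
      (R₂ := 2 * (|S| + 1)) (fun w hw => by
        rw [mem_closedBall, dist_eq_norm]
        linarith [norm_sub_le (v j w) (v j p), hj w hw, hj p (mem_ball_self hr), le_abs_self S])
      (ball_subset_ball (min_le_left _ _) hz)
    refine h1.trans_lt ?_
    calc 2 * (|S| + 1) / r * dist z p < 2 * (|S| + 1) / r * (ε * r / (2 * (|S| + 1))) := by
          gcongr
          exact lt_of_lt_of_le hz (min_le_right _ _)
      _ = ε := by field_simp
  have hpt : ∀ p ∈ W, ∃ l, Tendsto (fun j => v j p) atTop (𝓝 l) := by
    intro p hp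
    refine cauchySeq_tendsto_of_complete (Metric.cauchySeq_iff'.2 fun ε hε => ?_)
    obtain ⟨r, hr, hrW, hrv⟩ := hosc p hp (ε / 4) (by positivity)
    obtain ⟨d, hd, hdr⟩ := hD.exists_mem_open isOpen_ball ⟨p, mem_ball_self hr⟩
    obtain ⟨l, hl⟩ := hlim d hd (hrW hdr)
    obtain ⟨N, hN⟩ := eventually_atTop.1
      (hrv.and (Metric.tendsto_nhds.1 hl (ε / 4) (by positivity)))
    refine ⟨N, fun n hn => ?_⟩
    have h1 := (hN n hn).1 d hdr
    have h2 := (hN N le_rfl).1 d hdr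
    have h3 := (hN n hn).2
    have h4 := (hN N le_rfl).2
    rw [dist_comm] at h1
    linarith [dist_triangle4 (v n p) (v n d) (v N d) (v N p),
      dist_triangle_right (v n d) (v N d) l]
  choose! g hg using hpt
  have hunif : TendstoLocallyUniformlyOn v g atTop W := by
    rw [Metric.tendstoLocallyUniformlyOn_iff]
    intro ε hε p hp
    obtain ⟨r, hr, hrW, hrv⟩ := hosc p hp (ε / 4) (by positivity)
    refine ⟨ball p r, mem_nhdsWithin_of_mem_nhds (ball_mem_nhds p hr), ?_⟩
    filter_upwards [hrv, Metric.tendsto_nhds.1 (hg p hp) (ε / 4) (by positivity)] with j hj hjp z hz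
    have h1 : dist (g z) (g p) ≤ ε / 4 := le_of_tendsto ((hg z (hrW hz)).dist (hg p hp))
      (hrv.mono fun k hk => (hk z hz).le)
    have h2 := hj z hz
    rw [dist_comm] at h2 hjp
    linarith [dist_triangle4 (g z) (g p) (v j p) (v j z)]
  exact ⟨g, hunif.differentiableOn_complex hW hv, hunif⟩

/-- If a sequence of holomorphic functions satisfies a Schottky-type bound on the balls contained
in `Ω`, and at each point of a dense set it converges or tends to infinity, then on each component
of `Ω` it converges locally uniformly to a holomorphic function, or tends to infinity uniformly on
compact sets. -/
theorem tendstoLocallyUniformlyOn_or_tendsto_infty_of_schottky [LocallyCompactSpace E]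
    {v : ℕ → E → ℂ} {Ω D : Set E} (hΩ : IsOpen Ω) (hv : ∀ j, DifferentiableOn ℂ (v j) Ω)
    (hsch : ∀ M : ℝ, ∃ S : ℝ, ∀ j c r, ball c r ⊆ Ω → ‖v j c‖ ≤ M →
      ∀ z ∈ ball c (r / 2), ‖v j z‖ ≤ S)
    (hD : Dense D)
    (hlim : ∀ d ∈ D, (∃ l, Tendsto (fun j => v j d) atTop (𝓝 l)) ∨
      Tendsto (fun j => ‖v j d‖) atTop atTop) {p₀ : E} (hp₀ : p₀ ∈ Ω) :
    (∃ g : E → ℂ, DifferentiableOn ℂ g (connectedComponentIn Ω p₀) ∧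
      TendstoLocallyUniformlyOn v g atTop (connectedComponentIn Ω p₀)) ∨
    (∀ K ⊆ connectedComponentIn Ω p₀, IsCompact K → ∀ M : ℝ, ∀ᶠ j in atTop, ∀ z ∈ K,
      M < ‖v j z‖) := by
  set A : Set E := {p | ∃ r > 0, ∃ S : ℝ, ∀ᶠ j in atTop, ∀ z ∈ ball p r, ‖v j z‖ ≤ S} with hA
  set B : Set E := {p | ∃ r > 0, ∀ M : ℝ, ∀ᶠ j in atTop, ∀ z ∈ ball p r, M < ‖v j z‖} with hB
  have hsmall : ∀ (p : E) (r : ℝ), ∀ q ∈ ball p r, ball q (r - dist q p) ⊆ ball p r :=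
    fun p r q _ => ball_subset_ball' (by linarith)
  have hAo : IsOpen A := by
    refine Metric.isOpen_iff.2 fun p hp => ?_
    obtain ⟨r, hr, S, hS⟩ := hp
    refine ⟨r, hr, fun q hq => ⟨r - dist q p, by linarith [mem_ball.1 hq], S, ?_⟩⟩
    exact hS.mono fun j hj z hz => hj z (hsmall p r q hq hz)
  have hBo : IsOpen B := by
    refine Metric.isOpen_iff.2 fun p hp => ?_
    obtain ⟨r, hr, hS⟩ := hp
    refine ⟨r, hr, fun q hq => ⟨r - dist q p, by linarith [mem_ball.1 hq], fun M => ?_⟩⟩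
    exact (hS M).mono fun j hj z hz => hj z (hsmall p r q hq hz)
  have hAB : Disjoint A B := by
    refine Set.disjoint_left.2 fun p hpA hpB => ?_
    obtain ⟨r, hr, S, hS⟩ := hpA
    obtain ⟨r', hr', hS'⟩ := hpB
    obtain ⟨j, hj, hj'⟩ := (hS.and (hS' S)).exists
    exact (hj p (mem_ball_self hr)).not_gt (hj' p (mem_ball_self hr'))
  have hcover : Ω ⊆ A ∪ B := by
    intro p hp
    obtain ⟨R, hR, hRΩ⟩ := Metric.isOpen_iff.1 hΩ p hp
    obtain ⟨d, hd, hdR⟩ := hD.exists_mem_open isOpen_ball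
      ⟨p, mem_ball_self (by positivity : 0 < R / 8)⟩
    rw [mem_ball] at hdR
    rcases hlim d hd with ⟨l, hl⟩ | hinf
    · obtain ⟨S, hS⟩ := hsch (‖l‖ + 1)
      refine Or.inl ⟨R / 8, by positivity, S, ?_⟩
      filter_upwards [hl.norm.eventually (eventually_le_nhds (lt_add_one ‖l‖))] with j hj z hz
      rw [mem_ball] at hz
      refine hS j d (R / 2) ((ball_subset_ball' (by linarith)).trans hRΩ) hj z ?_
      rw [mem_ball]
      linarith [dist_triangle_right z d p]
    -- Schottky in reverse: a value of size at most `M` at `z` would bound the values at `d`, which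
    -- tend to infinity.
    · refine Or.inr ⟨R / 8, by positivity, fun M => ?_⟩
      obtain ⟨S, hS⟩ := hsch M
      filter_upwards [hinf.eventually_gt_atTop S] with j hj z hz
      rw [mem_ball] at hz
      by_contra! hM
      refine (hS j z (R * 3 / 4) ((ball_subset_ball' (by linarith)).trans hRΩ) hM d ?_).not_gt hj
      rw [mem_ball]
      linarith [dist_triangle_right d z p]
  have hCΩ := connectedComponentIn_subset Ω p₀
  have hCo : IsOpen (connectedComponentIn Ω p₀) := by
    have : LocallyConnectedSpace E := by
      let := NormedSpace.restrictScalars ℝ ℂ E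
      infer_instance
    exact hΩ.connectedComponentIn
  have hp₀C := mem_connectedComponentIn hp₀
  rcases hcover hp₀ with h | h
  · left
    have hCA := IsPreconnected.subset_left_of_subset_union hAo hBo hAB (hCΩ.trans hcover)
      ⟨p₀, hp₀C, h⟩ isPreconnected_connectedComponentIn
    refine exists_tendstoLocallyUniformlyOn_of_tendsto_dense hCo (fun j => (hv j).mono hCΩ) hD
      (fun p hp => ?_) (fun d hd hdC => ?_)
    · obtain ⟨r, hr, S, hS⟩ := hCA hp
      obtain ⟨R, hR, hRC⟩ := Metric.isOpen_iff.1 hCo p hp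
      exact ⟨min r R, lt_min hr hR, S, (ball_subset_ball (min_le_right _ _)).trans hRC,
        hS.mono fun j hj z hz => hj z (ball_subset_ball (min_le_left _ _) hz)⟩
    · refine (hlim d hd).resolve_right fun hinf => ?_
      obtain ⟨r, hr, S, hS⟩ := hCA hdC
      obtain ⟨j, hj, hj'⟩ := (hS.and (hinf.eventually_gt_atTop S)).exists
      exact (hj d (mem_ball_self hr)).not_gt hj'
  · right
    have hCB := IsPreconnected.subset_right_of_subset_union hAo hBo hAB (hCΩ.trans hcover)
      ⟨p₀, hp₀C, h⟩ isPreconnected_connectedComponentIn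
    intro K hK hKc M
    refine hKc.induction_on (p := fun K => ∀ᶠ j in atTop, ∀ z ∈ K, M < ‖v j z‖) (by simp)
      (fun s t hst ht => ht.mono fun j hj z hz => hj z (hst hz)) (fun s t hs ht => ?_)
      (fun x hx => ?_)
    · filter_upwards [hs, ht] with j hjs hjt z hz
      exact hz.elim (hjs z) (hjt z)
    · obtain ⟨r, hr, h⟩ := hCB (hK hx)
      exact ⟨ball x r, mem_nhdsWithin_of_mem_nhds (ball_mem_nhds x hr), h M⟩

end SeveralVariables

/-! ### Chordal distance estimates and the conclusion. -/

theorem chordalDist_coe_infty_le_one (z : ℂ) : chordalDist z OnePoint.infty ≤ 1 := by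
  change 1 / √(1 + ‖z‖ ^ 2) ≤ 1
  rw [div_le_one (by positivity)]
  exact Real.one_le_sqrt.2 (by nlinarith [norm_nonneg z])

theorem chordalDist_coe_infty_nonneg (z : ℂ) : 0 ≤ chordalDist z OnePoint.infty := by
  change 0 ≤ 1 / √(1 + ‖z‖ ^ 2)
  positivity

theorem chordalDist_infty_coe (z : ℂ) :
    chordalDist OnePoint.infty z = chordalDist z OnePoint.infty := rfl

theorem norm_mul_chordalDist_coe_infty_le_one (z : ℂ) :
    ‖z‖ * chordalDist z OnePoint.infty ≤ 1 := by
  change ‖z‖ * (1 / √(1 + ‖z‖ ^ 2)) ≤ 1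
  rw [mul_one_div, div_le_one (by positivity)]
  exact Real.le_sqrt_of_sq_le (by linarith)

theorem chordalDist_coe_coe (z w : ℂ) : chordalDist z w
    = ‖z - w‖ * (chordalDist z OnePoint.infty * chordalDist w OnePoint.infty) := by
  change ‖z - w‖ / (√(1 + ‖z‖ ^ 2) * √(1 + ‖w‖ ^ 2))
    = ‖z - w‖ * (1 / √(1 + ‖z‖ ^ 2) * (1 / √(1 + ‖w‖ ^ 2)))
  rw [div_mul_div_comm, one_mul, mul_one_div]

/-- A lower bound on the product of the mutual chordal distances of `a`, `b` and `∞` bounds `a` and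
`b`, and keeps them apart. -/
theorem norm_le_of_lt_chordalDist_mul {a b : ℂ} {ε : ℝ} (hε : 0 < ε)
    (h : ε < chordalDist a OnePoint.infty * chordalDist a b * chordalDist OnePoint.infty b) :
    ‖a‖ ≤ 2 / ε ∧ ‖b‖ ≤ 2 / ε ∧ ε ≤ ‖a - b‖ := by
  rw [chordalDist_infty_coe, chordalDist_coe_coe] at h
  have ha0 := chordalDist_coe_infty_nonneg a
  have hb0 := chordalDist_coe_infty_nonneg b
  have ha1 := chordalDist_coe_infty_le_one a
  have hb1 := chordalDist_coe_infty_le_one b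
  have ha := norm_mul_chordalDist_coe_infty_le_one a
  have hb := norm_mul_chordalDist_coe_infty_le_one b
  set x := chordalDist a OnePoint.infty
  set y := chordalDist b OnePoint.infty
  have hx2 : x ^ 2 ≤ 1 := by nlinarith
  have hy2 : y ^ 2 ≤ 1 := by nlinarith
  -- `h` now reads `ε < ‖a - b‖ x² y²`. As `‖a‖ x`, `‖b‖ y`, `x`, `y` are all at most `1`, this
  -- gives `ε ≤ 2 x y`, and `‖a‖ x ≤ 1` turns it into a bound on `‖a‖`; likewise for `b`.
  have hxy : ‖a - b‖ * (x * y) ≤ 2 := by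
    have h1 := mul_le_mul_of_nonneg_right (norm_sub_le a b) (mul_nonneg ha0 hb0)
    nlinarith [mul_le_mul_of_nonneg_right ha hb0, mul_le_mul_of_nonneg_right hb ha0]
  have hsep : ε ≤ ‖a - b‖ := by
    have h1 : x ^ 2 * y ^ 2 ≤ 1 := mul_le_one₀ hx2 (sq_nonneg y) hy2
    nlinarith [mul_le_mul_of_nonneg_left h1 (norm_nonneg (a - b))]
  have hεx : ε ≤ 2 * x := by
    have h1 : ‖a - b‖ * (x * y) * (x * y) ≤ 2 * (x * y) :=
      mul_le_mul_of_nonneg_right hxy (mul_nonneg ha0 hb0)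
    have h2 : x * y ≤ x := mul_le_of_le_one_right ha0 hb1
    nlinarith
  have hεy : ε ≤ 2 * y := by
    have h1 : ‖a - b‖ * (x * y) * (x * y) ≤ 2 * (x * y) :=
      mul_le_mul_of_nonneg_right hxy (mul_nonneg ha0 hb0)
    have h2 : x * y ≤ y := mul_le_of_le_one_left hb0 ha1
    nlinarith
  refine ⟨?_, ?_, hsep⟩
  · rw [le_div_iff₀ hε]
    nlinarith [mul_le_mul_of_nonneg_left hεx (norm_nonneg a)]
  · rw [le_div_iff₀ hε]
    nlinarith [mul_le_mul_of_nonneg_left hεy (norm_nonneg b)]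

theorem mainTheorem3 (n : ℕ) (Ω : Set (EuclideanSpace ℂ (Fin n))) (hΩ : IsOpen Ω)
    (F : Set (EuclideanSpace ℂ (Fin n) → ℂ)) (hF : ∀ f ∈ F, DifferentiableOn ℂ f Ω)
    (ε : ℝ) (hε : 0 < ε)
    (hval : ∀ f ∈ F, ∃ a b : ℂ, a ≠ b ∧ (∀ z ∈ Ω, f z ≠ a ∧ f z ≠ b) ∧
      ε < chordalDist a OnePoint.infty * chordalDist a b * chordalDist OnePoint.infty b) :
    IsNormalFamilyOn F Ω := by
  intro u hu
  obtain ⟨D, hDc, hD⟩ := TopologicalSpace.exists_countable_dense (EuclideanSpace ℂ (Fin n))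
  have : Countable D := hDc.to_subtype
  obtain ⟨φ, hφ, hlim⟩ := exists_subseq_tendsto_or_tendsto_norm_atTop (fun j (d : D) => u j d)
  refine ⟨φ, hφ, fun p hp => ?_⟩
  have hsch : ∀ M : ℝ, ∃ S : ℝ, ∀ j c r, Metric.ball c r ⊆ Ω → ‖u (φ j) c‖ ≤ M →
      ∀ z ∈ Metric.ball c (r / 2), ‖u (φ j) z‖ ≤ S := by
    intro M
    obtain ⟨S, hS⟩ := exists_schottky_bound (EuclideanSpace ℂ (Fin n)) (A := 2 / ε) hε M
    refine ⟨S, fun j c r hr hc => ?_⟩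
    obtain ⟨a, b, -, hab, hlt⟩ := hval _ (hu (φ j))
    obtain ⟨h1, h2, h3⟩ := norm_le_of_lt_chordalDist_mul hε hlt
    exact hS _ c r a b ((hF _ (hu _)).mono hr) h1 h2 h3 (fun z hz => hab z (hr hz)) hc
  have hCo : IsOpen (connectedComponentIn Ω p) := hΩ.connectedComponentIn
  refine (tendstoLocallyUniformlyOn_or_tendsto_infty_of_schottky (v := fun j => u (φ j)) hΩ
    (fun j => hF _ (hu _)) hsch hD (fun d hd => hlim ⟨d, hd⟩) hp).imp_left ?_
  rintro ⟨g, hg, hlu⟩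
  exact ⟨g, hg, (tendstoLocallyUniformlyOn_iff_forall_isCompact hCo).1 hlu⟩
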